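/- **RSLR with pairs.** Aspects are $\square$ (modal) and $\blacksquare$ (non-modal), ordered by $\square<:\square$, $\square<:\blacksquare$, $\blacksquare<:\blacksquare$. Base types are $G::=\mathbf N\mid G\times G$; types are $A::=G\mid aA\to A$ with $a$ an aspect. Subtyping is the reflexive transitive relation generated by: $B<:A$, $C<:D$, $b<:a$ imply $(aA\to C)<:(bB\to D)$. A type is $\square$-free if $\square$ does not occur in it. Terms (modulo $\alpha$-conversion) are $$t::=x\mid c\mid ts\mid\lambda x{:}aA.t\mid\mathtt{case}_A\,t\,\mathtt{zero}\,s\,\mathtt{even}\,r\,\mathtt{odd}\,q\mid\mathtt{recursion}_A\,t\,s\,r\mid\langle t,s\rangle\mid\pi_1(t)\mid\pi_2(t),\qquad c::=n\mid S_0\mid S_1\mid P\mid\mathtt{rand}\quad(n\in\mathbb N),$$ with $\mathrm{type}(n)=\mathrm{type}(\mathtt{rand})=\mathbf N$ and $\mathrm{type}(S_0)=\mathrm{type}(S_1)=\mathrm{type}(P)=\blacksquare\mathbf N\to\mathbf N$. Contexts are finite sets of assignments $x:aA$ to distinct variables; $\Gamma,\Delta$ is the union of contexts with disjoint domains, written $\Gamma;\Delta$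 if moreover all types in $\Gamma$ are base types; $\Gamma<:a$ means $b<:a$ for all aspects $b$ in $\Gamma$. The typing rules are: * $\Gamma\vdash x:A$ if $x:aA\in\Gamma$; $\Gamma\vdash c:\mathrm{type}(c)$; from $\Gamma\vdash t:A$ and $A<:B$ infer $\Gamma\vdash t:B$; from $\Gamma,x:aA\vdash t:B$ infer $\Gamma\vdash\lambda x{:}aA.t:aA\to B$; * from $\Gamma;\Delta_1\vdash t:aA\to B$, $\Gamma;\Delta_2\vdash s:A$ and $\Gamma,\Delta_2<:a$ infer $\Gamma;\Delta_1,\Delta_2\vdash ts:B$; * from $\Gamma;\Delta_1\vdash t:\mathbf N$, $\Gamma;\Delta_2\vdash s:A$, $\Gamma;\Delta_3\vdash r:A$, $\Gamma;\Delta_4\vdash q:A$ with $A$ $\square$-free infer $\Gamma;\Delta_1,\Delta_2,\Delta_3,\Delta_4\vdash\mathtt{case}_A\,t\,\mathtt{zero}\,s\,\mathtt{even}\,r\,\mathtt{odd}\,q:A$; * from $\Gamma_1;\Delta_1\vdash t:\mathbf N$, $\Gamma_1,\Gamma_2;\Delta_2\vdash s:A$, $\Gamma_1,\Gamma_2;\vdash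 r:\square\mathbf N\to\blacksquare A\to A$, $\Gamma_1,\Delta_1<:\square$ with $A$ $\square$-free infer $\Gamma_1,\Gamma_2;\Delta_1,\Delta_2\vdash\mathtt{recursion}_A\,t\,s\,r:A$; * from $\Gamma;\Delta_1\vdash t:G$ and $\Gamma;\Delta_2\vdash s:F$ ($G,F$ base types) infer $\Gamma;\Delta_1,\Delta_2\vdash\langle t,s\rangle:G\times F$; from $\Gamma\vdash t:G\times F$ infer $\Gamma\vdash\pi_1(t):G$ and $\Gamma\vdash\pi_2(t):F$. A *first-order term of arity $k$* is a closed term of type $a_1\mathbf N\to\cdots\to a_k\mathbf N\to\mathbf N$ for some aspects $a_1,\dots,a_k$. One-step reduction relates a term to a nonempty sequence of terms. It is generated by the following axioms, closed under all contexts except the second and third argument of a recursion (a context is applied to every member of the sequence): $\mathtt{case}_A\,n\,\mathtt{zero}\,t\,\mathtt{even}\,s\,\mathtt{odd}\,r$ reduces to $t$ if $n=0$, to $s$ if $n\ge1$ is even, to $r$ if $n$ is odd; $\mathtt{recursion}_A\,0\,g\,f\to g$; $\mathtt{recursion}_A\,n\,g\,f\to f\,n\,(\mathtt{recursion}_A\,\lfloor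 n/2\rfloor\,g\,f)$ for $n\ge1$; $S_0n\to2n$; $S_1n\to2n+1$; $Pn\to\lfloor n/2\rfloor$; $(\lambda x{:}aG.t)v\to t[v/x]$ for $G$ a base type and $v$ a value (a numeral or a pair of values); $(\lambda x{:}aH.t)s\to t[s/x]$ for $H$ a function type; $(\lambda x{:}aA.t)sr\to(\lambda x{:}aA.tr)s$ ($x$ not free in $r$); $\pi_1(\langle t,s\rangle)\to t$; $\pi_2(\langle t,s\rangle)\to s$; $\mathtt{rand}\to0,1$. Evaluation $t\rightsquigarrow\mathscr D$ of terms to probability distributions on terms is defined inductively: if $t$ is in normal form, then $t\rightsquigarrow$ the distribution concentrated on $t$; if $t\to t_1,\dots,t_n$ and $t_i\rightsquigarrow\mathscr D_i$ for all $i$, then $t\rightsquigarrow\sum_{i=1}^n\frac1n\mathscr D_i$. **Machines.** A probabilistic Turing machine $M$ has a finite set of states with an initial state and a set of final states, one two-way infinite tape over a finite alphabet that contains three distinct symbols $0,1,\sqcup$, and for each state and scanned symbol two (possibly equal) actions (new state, written symbol, head move $\leftarrow,\downarrow$ or $\rightarrow$), one of which is selected at each step by a fair coin toss; it halts when it reaches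 a final state. On input $n\in\mathbb N$ the tape contains the binary representation of $n$, most significant digit first (no digit for $n=0$), and is otherwise blank, with the head on the first digit. The result of a halted computation is the number whose binary digits, most significant first, stand on the tape from the head to the right, up to the first symbol other than $0,1$. $M$ runs in polynomial time if there is a polynomial $p$ with natural coefficients such that on every input $n$ and for all outcomes of the coin tosses $M$ halts within $p(|n|)$ steps, where $|n|$ is the number of binary digits of $n$ ($|0|=0$). **Theorem.** Let $M$ be a probabilistic Turing machine running in polynomial time, and for every $n\in\mathbb N$ let $\mathscr D_n$ be the probability distribution on $\mathbb N$ of the results of $M$ on input $n$. Then there is a first-order term $t$ of arity $1$ of RSLR with pairs such that for every $n\in\mathbb N$, $t\,n\rightsquigarrow\mathscr D_n$, where $\mathscr D_n$ is regarded as a distribution on terms supported on numerals. -/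

import Mathlib

namespace RSLR

/-! ### Types and subtyping -/

/-- Base types: natural numbers and pairs of base types. -/
inductive BTy : Type
  | nat : BTy
  | prod : BTy → BTy → BTy

/-- The aspects: `modal` is `□`, `nonmodal` is `■`. -/
inductive Aspect : Type
  | modal : Aspect
  | nonmodal : Aspect

/-- The order `{(□,□), (□,■), (■,■)}` on aspects. -/
def Aspect.Le (a b : Aspect) : Prop := a = .modal ∨ b = .nonmodal

/-- Types: base types and function types `a A → B`, with `a` an aspect. -/
inductive Ty : Type
  | base : BTy → Ty
  | arr : Aspect → Ty → Ty → Ty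

/-- The type `N`. -/
abbrev Ty.nat : Ty := .base .nat

def Ty.IsBase : Ty → Prop
  | .base _ => True
  | .arr _ _ _ => False

/-- No occurrence of `□` in the type. -/
def Ty.BoxFree : Ty → Prop
  | .base _ => True
  | .arr a A B => a = .nonmodal ∧ A.BoxFree ∧ B.BoxFree

inductive Sub : Ty → Ty → Prop
  | refl (A : Ty) : Sub A A
  | trans {A B C : Ty} : Sub A B → Sub B C → Sub A C
  | arr {a b : Aspect} {A B C D : Ty} :
      Sub B A → Sub C D → b.Le a → Sub (.arr a A C) (.arr b B D)

/-! ### Terms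

Terms modulo renaming of bound variables, as de Bruijn terms: `var 0` is the variable bound by
the innermost enclosing abstraction. -/

inductive Cst : Type
  | num : ℕ → Cst
  | S0 : Cst
  | S1 : Cst
  | P : Cst
  | rand : Cst

/-- The type of a constant. -/
def Cst.ty : Cst → Ty
  | .num _ => .nat
  | .S0 => .arr .nonmodal .nat .nat
  | .S1 => .arr .nonmodal .nat .nat
  | .P => .arr .nonmodal .nat .nat
  | .rand => .nat

inductive Tm : Type
  | var : ℕ → Tm
  | cst : Cst → Tm
  | app : Tm → Tm → Tm
  /-- `lam a A t` is `λ x : a A. t`. -/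
  | lam : Aspect → Ty → Tm → Tm
  /-- `caseOf A t s r q` is `case_A t zero s even r odd q`. -/
  | caseOf : Ty → Tm → Tm → Tm → Tm → Tm
  /-- `recursion A t s r` is `recursion_A t s r`: argument `t`, base value `s`, step `r`. -/
  | recursion : Ty → Tm → Tm → Tm → Tm
  | pair : Tm → Tm → Tm
  | fst : Tm → Tm
  | snd : Tm → Tm

namespace Tm

/-- The numeral `n`. -/
abbrev num (n : ℕ) : Tm := .cst (.num n)

/-- Extend a renaming under a binder. -/
def upRen (ρ : ℕ → ℕ) : ℕ → ℕ
  | 0 => 0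
  | i + 1 => ρ i + 1

def rename : Tm → (ℕ → ℕ) → Tm
  | var i, ρ => var (ρ i)
  | cst c, _ => cst c
  | app t s, ρ => app (t.rename ρ) (s.rename ρ)
  | lam a A t, ρ => lam a A (t.rename (upRen ρ))
  | caseOf A t s r q, ρ => caseOf A (t.rename ρ) (s.rename ρ) (r.rename ρ) (q.rename ρ)
  | recursion A t s r, ρ => recursion A (t.rename ρ) (s.rename ρ) (r.rename ρ)
  | pair t s, ρ => pair (t.rename ρ) (s.rename ρ)
  | fst t, ρ => fst (t.rename ρ)
  | snd t, ρ => snd (t.rename ρ)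

/-- Extend a simultaneous substitution under a binder. -/
def upSubst (σ : ℕ → Tm) : ℕ → Tm
  | 0 => var 0
  | i + 1 => (σ i).rename Nat.succ

/-- Simultaneous capture-avoiding substitution. -/
def subst : Tm → (ℕ → Tm) → Tm
  | var i, σ => σ i
  | cst c, _ => cst c
  | app t s, σ => app (t.subst σ) (s.subst σ)
  | lam a A t, σ => lam a A (t.subst (upSubst σ))
  | caseOf A t s r q, σ => caseOf A (t.subst σ) (s.subst σ) (r.subst σ) (q.subst σ)
  | recursion A t s r, σ => recursion A (t.subst σ) (s.subst σ) (r.subst σ)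
  | pair t s, σ => pair (t.subst σ) (s.subst σ)
  | fst t, σ => fst (t.subst σ)
  | snd t, σ => snd (t.subst σ)

/-- The substitution that sends the innermost variable to `s` and fixes the others. -/
def single (s : Tm) : ℕ → Tm
  | 0 => s
  | i + 1 => var i

/-- `t.inst s` is `t[s/x]`, for `x` the innermost variable of `t`. -/
def inst (t s : Tm) : Tm := t.subst (single s)

end Tm

/-! ### Reduction -/

/-- The values of base type: numerals and pairs of values. -/
inductive Value : Tm → Prop
  | num (n : ℕ) : Value (.num n)
  | pair {t s : Tm} : Value t → Value s → Value (.pair t s)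

open Tm in
/-- One-step reduction `t → t₀, …, tₙ` between terms and nonempty sequences of terms: the axioms,
closed under every context except the second and third argument of a recursion. -/
inductive Red : Tm → {n : ℕ} → (Fin (n + 1) → Tm) → Prop
  | caseZero (A : Ty) (t s r : Tm) : Red (caseOf A (num 0) t s r) ![t]
  | caseEven (A : Ty) (n : ℕ) (t s r : Tm) :
      n ≠ 0 → Red (caseOf A (num (2 * n)) t s r) ![s]
  | caseOdd (A : Ty) (n : ℕ) (t s r : Tm) : Red (caseOf A (num (2 * n + 1)) t s r) ![r]
  | recZero (A : Ty) (g f : Tm) : Red (recursion A (num 0) g f) ![g]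
  | recStep (A : Ty) (n : ℕ) (g f : Tm) : n ≠ 0 →
      Red (recursion A (num n) g f) ![app (app f (num n)) (recursion A (num (n / 2)) g f)]
  | S0 (n : ℕ) : Red (app (cst .S0) (num n)) ![num (2 * n)]
  | S1 (n : ℕ) : Red (app (cst .S1) (num n)) ![num (2 * n + 1)]
  | P (n : ℕ) : Red (app (cst .P) (num n)) ![num (n / 2)]
  | betaBase (a : Aspect) (G : BTy) (t v : Tm) :
      Value v → Red (app (lam a (.base G) t) v) ![t.inst v]
  | betaArr (a b : Aspect) (A B : Ty) (t s : Tm) :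
      Red (app (lam a (.arr b A B) t) s) ![t.inst s]
  | swap (a : Aspect) (A : Ty) (t s r : Tm) :
      Red (app (app (lam a A t) s) r) ![app (lam a A (app t (r.rename Nat.succ))) s]
  | rand : Red (cst .rand) ![num 0, num 1]
  | fstPair (t s : Tm) : Red (fst (pair t s)) ![t]
  | sndPair (t s : Tm) : Red (snd (pair t s)) ![s]
  | appL {t : Tm} {n : ℕ} {ts : Fin (n + 1) → Tm} (s : Tm) :
      Red t ts → Red (app t s) fun i => app (ts i) s
  | appR {t : Tm} {n : ℕ} {ts : Fin (n + 1) → Tm} (s : Tm) :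
      Red t ts → Red (app s t) fun i => app s (ts i)
  | lam {t : Tm} {n : ℕ} {ts : Fin (n + 1) → Tm} (a : Aspect) (A : Ty) :
      Red t ts → Red (lam a A t) fun i => lam a A (ts i)
  | case1 {t : Tm} {n : ℕ} {ts : Fin (n + 1) → Tm} (A : Ty) (s r q : Tm) :
      Red t ts → Red (caseOf A t s r q) fun i => caseOf A (ts i) s r q
  | case2 {t : Tm} {n : ℕ} {ts : Fin (n + 1) → Tm} (A : Ty) (s r q : Tm) :
      Red t ts → Red (caseOf A s t r q) fun i => caseOf A s (ts i) r q
  | case3 {t : Tm} {n : ℕ} {ts : Fin (n + 1) → Tm} (A : Ty) (s r q : Tm) :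
      Red t ts → Red (caseOf A s r t q) fun i => caseOf A s r (ts i) q
  | case4 {t : Tm} {n : ℕ} {ts : Fin (n + 1) → Tm} (A : Ty) (s r q : Tm) :
      Red t ts → Red (caseOf A s r q t) fun i => caseOf A s r q (ts i)
  | recArg {t : Tm} {n : ℕ} {ts : Fin (n + 1) → Tm} (A : Ty) (g f : Tm) :
      Red t ts → Red (recursion A t g f) fun i => recursion A (ts i) g f
  | pairL {t : Tm} {n : ℕ} {ts : Fin (n + 1) → Tm} (s : Tm) :
      Red t ts → Red (pair t s) fun i => pair (ts i) s
  | pairR {t : Tm} {n : ℕ} {ts : Fin (n + 1) → Tm} (s : Tm) :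
      Red t ts → Red (pair s t) fun i => pair s (ts i)
  | fst {t : Tm} {n : ℕ} {ts : Fin (n + 1) → Tm} :
      Red t ts → Red (fst t) fun i => fst (ts i)
  | snd {t : Tm} {n : ℕ} {ts : Fin (n + 1) → Tm} :
      Red t ts → Red (snd t) fun i => snd (ts i)

/-- `t` is in normal form. -/
def NF (t : Tm) : Prop := ∀ (n : ℕ) (ts : Fin (n + 1) → Tm), ¬ Red t ts

/-- Multistep reduction `t ⇝ 𝒟` of terms to probability distributions on terms: either `t` is in
normal form and `𝒟` is concentrated on `t`, or `t → t₀, …, tₙ`, `tᵢ ⇝ 𝒟ᵢ` and `𝒟` is the mean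
of the `𝒟ᵢ`. -/
inductive Eval : Tm → PMF Tm → Prop
  | nf {t : Tm} : NF t → Eval t (PMF.pure t)
  | step {t : Tm} {n : ℕ} {ts : Fin (n + 1) → Tm} {D : Fin (n + 1) → PMF Tm} :
      Red t ts → (∀ i, Eval (ts i) (D i)) →
      Eval t ((PMF.uniformOfFintype (Fin (n + 1))).bind D)

/-! ### Typing -/

/-- Contexts: partial maps from (de Bruijn indices of) variables to aspects and types. All contexts
in a derivation whose conclusion has the empty context have finite domain. -/
abbrev Ctx : Type := ℕ → Option (Aspect × Ty)

namespace Ctx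

def empty : Ctx := fun _ => none

/-- `Γ, x : a A`, for `x` the innermost variable. -/
def cons (a : Aspect) (A : Ty) (Γ : Ctx) : Ctx
  | 0 => some (a, A)
  | i + 1 => Γ i

/-- `Γ` and `Δ` have disjoint domains. -/
def Disj (Γ Δ : Ctx) : Prop := ∀ i, Γ i = none ∨ Δ i = none

/-- The union `Γ, Δ` (used for disjoint contexts only). -/
def union (Γ Δ : Ctx) : Ctx := fun i => (Γ i).or (Δ i)

/-- All types in `Γ` are base types. -/
def Base (Γ : Ctx) : Prop := ∀ i a A, Γ i = some (a, A) → A.IsBase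

/-- `Γ <: a`: every aspect `b` in `Γ` satisfies `b <: a`. -/
def Le (Γ : Ctx) (a : Aspect) : Prop := ∀ i b A, Γ i = some (b, A) → b.Le a

end Ctx

open Tm in
/-- `Typed Γ t A` is `Γ ⊢ t : A`. The contexts named `Γ` below are shared by the premises and hold
base types only; the contexts named `Δ` are split between the premises. -/
inductive Typed : Ctx → Tm → Ty → Prop
  | var {Γ : Ctx} {i : ℕ} {a : Aspect} {A : Ty} : Γ i = some (a, A) → Typed Γ (var i) A
  | sub {Γ : Ctx} {t : Tm} {A B : Ty} : Typed Γ t A → Sub A B → Typed Γ t B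
  | lam {Γ : Ctx} {t : Tm} {a : Aspect} {A B : Ty} :
      Typed (Γ.cons a A) t B → Typed Γ (lam a A t) (.arr a A B)
  | cst {Γ : Ctx} (c : Cst) : Typed Γ (cst c) c.ty
  | caseOf {Γ Δ₁ Δ₂ Δ₃ Δ₄ : Ctx} {t s r q : Tm} {A : Ty} :
      [Γ, Δ₁, Δ₂, Δ₃, Δ₄].Pairwise Ctx.Disj → Γ.Base →
      Typed (Γ.union Δ₁) t .nat → Typed (Γ.union Δ₂) s A →
      Typed (Γ.union Δ₃) r A → Typed (Γ.union Δ₄) q A → A.BoxFree →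
      Typed (Γ.union (Δ₁.union (Δ₂.union (Δ₃.union Δ₄)))) (caseOf A t s r q) A
  | recursion {Γ₁ Γ₂ Δ₁ Δ₂ : Ctx} {t s r : Tm} {A : Ty} :
      [Γ₁, Γ₂, Δ₁, Δ₂].Pairwise Ctx.Disj → Γ₁.Base → Γ₂.Base →
      Typed (Γ₁.union Δ₁) t .nat → Typed ((Γ₁.union Γ₂).union Δ₂) s A →
      Typed (Γ₁.union Γ₂) r (.arr .modal .nat (.arr .nonmodal A A)) →
      (Γ₁.union Δ₁).Le .modal → A.BoxFree →
      Typed ((Γ₁.union Γ₂).union (Δ₁.union Δ₂)) (recursion A t s r) A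
  | app {Γ Δ₁ Δ₂ : Ctx} {t s : Tm} {a : Aspect} {A B : Ty} :
      [Γ, Δ₁, Δ₂].Pairwise Ctx.Disj → Γ.Base →
      Typed (Γ.union Δ₁) t (.arr a A B) → Typed (Γ.union Δ₂) s A → (Γ.union Δ₂).Le a →
      Typed (Γ.union (Δ₁.union Δ₂)) (app t s) B
  | pair {Γ Δ₁ Δ₂ : Ctx} {t s : Tm} {G F : BTy} :
      [Γ, Δ₁, Δ₂].Pairwise Ctx.Disj → Γ.Base →
      Typed (Γ.union Δ₁) t (.base G) → Typed (Γ.union Δ₂) s (.base F) →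
      Typed (Γ.union (Δ₁.union Δ₂)) (pair t s) (.base (.prod G F))
  | fst {Γ : Ctx} {t : Tm} {G F : BTy} :
      Typed Γ t (.base (.prod G F)) → Typed Γ (fst t) (.base G)
  | snd {Γ : Ctx} {t : Tm} {G F : BTy} :
      Typed Γ t (.base (.prod G F)) → Typed Γ (snd t) (.base F)

/-- The type `a₁ N → a₂ N → ⋯ → aₖ N → N`. -/
def firstOrderTy : List Aspect → Ty
  | [] => .nat
  | a :: as => .arr a .nat (firstOrderTy as)

/-- First-order terms of arity `k`: closed terms of type `a₁ N → ⋯ → aₖ N → N` for some aspects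
`a₁, …, aₖ`. -/
def IsFirstOrder (k : ℕ) (t : Tm) : Prop :=
  ∃ as : List Aspect, as.length = k ∧ Typed Ctx.empty t (firstOrderTy as)

end RSLR

/-! ### Probabilistic Turing machines -/

namespace PTM

/-- Head moves `←`, `↓`, `→`. -/
inductive Move : Type
  | left : Move
  | stay : Move
  | right : Move

/-- One-tape probabilistic Turing machines with states `Q` and tape alphabet `S`. For each state and
symbol, `trans` gives the two possible actions, one for each outcome of a coin toss. The alphabet
contains the blank and two further symbols, the binary digits `0` (`digit false`) and `1`
(`digit true`). -/
structure Machine (Q S : Type*) where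
  start : Q
  final : Set Q
  blank : S
  digit : Bool → S
  digit_injective : Function.Injective digit
  digit_ne_blank : ∀ b, digit b ≠ blank
  trans : Q → S → Bool → Q × S × Move

/-- Configurations: the state, the scanned symbol, and the parts of the tape to the left and to the
right of the head, both listed from the head outwards. All cells beyond the two lists are blank. -/
structure Cfg (Q S : Type*) where
  state : Q
  left : List S
  head : S
  right : List S

namespace Machine

variable {Q S : Type*}

/-- The configuration after a step, if the coin shows `b`. -/
def next (M : Machine Q S) (c : Cfg Q S) (b : Bool) : Cfg Q S :=
  match M.trans c.state c.head b with
  | (q, s, .left) => ⟨q, c.left.tail, c.left.headD M.blank, s :: c.right⟩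
  | (q, s, .stay) => ⟨q, c.left, s, c.right⟩
  | (q, s, .right) => ⟨q, s :: c.left, c.right.headD M.blank, c.right.tail⟩

open Classical in
/-- One step with a fair coin; configurations in a final state do not change any more. -/
noncomputable def stepDist (M : Machine Q S) (c : Cfg Q S) : PMF (Cfg Q S) :=
  if c.state ∈ M.final then PMF.pure c else (PMF.uniformOfFintype Bool).map (M.next c)

/-- The input `n`: its binary digits, most significant first (no digits for `n = 0`). -/
def input (M : Machine Q S) (n : ℕ) : List S := n.bits.reverse.map M.digit

/-- The initial configuration on input `n`: the head is on the first digit, the rest of the tape is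
blank. -/
def initial (M : Machine Q S) (n : ℕ) : Cfg Q S :=
  ⟨M.start, [], (M.input n).headD M.blank, (M.input n).tail⟩

/-- The distribution of configurations after `T` steps on input `n`. -/
noncomputable def run (M : Machine Q S) (n : ℕ) : ℕ → PMF (Cfg Q S)
  | 0 => PMF.pure (M.initial n)
  | T + 1 => (M.run n T).bind M.stepDist

open Classical in
/-- Read binary digits, most significant first, up to the first symbol that is not a digit, starting
from the value `k` of the digits read so far. -/
noncomputable def readFrom (M : Machine Q S) (k : ℕ) : List S → ℕ
  | [] => k
  | s :: l =>
      if s = M.digit false then M.readFrom (2 * k) l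
      else if s = M.digit true then M.readFrom (2 * k + 1) l
      else k

/-- The result of a halted configuration: the number whose binary digits stand on the tape from the
head to the right, up to the first symbol that is not a digit. -/
noncomputable def result (M : Machine Q S) (c : Cfg Q S) : ℕ := M.readFrom 0 (c.head :: c.right)

/-- On input `n`, every computation has halted after at most `T` steps, whatever the coins show. -/
def HaltsWithin (M : Machine Q S) (n T : ℕ) : Prop := ∀ c ∈ (M.run n T).support, c.state ∈ M.final

/-- The number of steps is bounded by a polynomial in the length of the binary representation of the
input, on all inputs and for all outcomes of the coin tosses. -/
def IsPolyTime (M : Machine Q S) : Prop :=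
  ∃ p : Polynomial ℕ, ∀ n : ℕ, M.HaltsWithin n (p.eval n.size)

open Classical in
/-- The distribution of the results of `M` on an input `n` on which `M` halts within a bounded number
of steps. -/
noncomputable def resultDist (M : Machine Q S) (n : ℕ) (h : ∃ T, M.HaltsWithin n T) : PMF ℕ :=
  (M.run n (Nat.find h)).map M.result

theorem IsPolyTime.halts {M : Machine Q S} (h : M.IsPolyTime) (n : ℕ) :
    ∃ T, M.HaltsWithin n T := by
  obtain ⟨p, hp⟩ := h
  exact ⟨_, hp n⟩

end Machine

end PTM

/-! Let closed terms of type `aE → F` sample from Markov kernels on encoded data. For every `a`,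
such kernels are closed under composition, pairing, coin tosses and case distinctions on
finitely many symbols, and one step of the machine is such a kernel on encoded configurations.
The higher-order result type of a recursion makes polynomially many steps out of one: recursion
on a modal number `n` turns a term of type `■E → E` into its `|n|`-fold iterate, again a term of
type `■E → E` in which `n` is available as a modal variable. Composing iterates adds the numbers
of steps and iterating them multiplies by `|n|`, so induction on the polynomial `p` gives
`p(|n|)` steps. Writing the input on the tape and reading the result off it are iterations of
length `|n|` as well, the latter for the number `n` that encodes the tape. -/

namespace RSLR

open Tm

/-! ### Typing -/

namespace Ctx

variable {Γ Δ Θ : Ctx}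

theorem union_empty (Γ : Ctx) : Γ.union empty = Γ := funext fun _ => Option.or_none

theorem empty_union (Γ : Ctx) : empty.union Γ = Γ := funext fun _ => Option.none_or

theorem union_assoc (Γ Δ Θ : Ctx) : (Γ.union Δ).union Θ = Γ.union (Δ.union Θ) :=
  funext fun _ => Option.or_assoc

theorem Disj.symm (h : Γ.Disj Δ) : Δ.Disj Γ := fun i => (h i).symm

theorem disj_empty (Γ : Ctx) : Γ.Disj empty := fun _ => .inr rfl

theorem empty_disj (Γ : Ctx) : empty.Disj Γ := fun _ => .inl rfl

theorem disj_union_left : (Γ.union Δ).Disj Θ ↔ Γ.Disj Θ ∧ Δ.Disj Θ := by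
  simp only [Disj, union, Option.or_eq_none_iff, ← forall_and, and_or_right]

theorem disj_union_right : Γ.Disj (Δ.union Θ) ↔ Γ.Disj Δ ∧ Γ.Disj Θ := by
  simp only [Disj, union, Option.or_eq_none_iff, ← forall_and, or_and_left]

theorem Disj.union_comm (h : Γ.Disj Δ) : Γ.union Δ = Δ.union Γ := by
  funext i
  rcases h i with hi | hi <;> simp [union, hi]

/-- `Γ` in the scope of one more binder, whose variable is not assigned a type. -/
def shift (Γ : Ctx) : Ctx
  | 0 => none
  | i + 1 => Γ i

theorem cons_union (a : Aspect) (A : Ty) (Γ Δ : Ctx) :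
    (Γ.union Δ).cons a A = (Γ.cons a A).union Δ.shift := by
  funext i
  cases i <;> rfl

theorem Disj.cons_shift (h : Γ.Disj Δ) (a : Aspect) (A : Ty) : (Γ.cons a A).Disj Δ.shift
  | 0 => .inr rfl
  | i + 1 => h i

/-- The assignment of `Γ` to the variable `i`, if any. -/
def only (Γ : Ctx) (i : ℕ) : Ctx := fun j => if j = i then Γ j else none

/-- `Γ` without its assignment to the variable `i`. -/
def erase (Γ : Ctx) (i : ℕ) : Ctx := fun j => if j = i then none else Γ j

theorem only_union_erase (Γ : Ctx) (i : ℕ) : (Γ.only i).union (Γ.erase i) = Γ := by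
  funext j
  by_cases h : j = i <;> simp [union, only, erase, h]

theorem only_disj_erase (Γ : Ctx) (i : ℕ) : (Γ.only i).Disj (Γ.erase i) := fun j => by
  by_cases h : j = i <;> simp [only, erase, h]

theorem base_empty : empty.Base := nofun

theorem Base.cons (h : Γ.Base) (a : Aspect) (G : BTy) : (Γ.cons a (.base G)).Base
  | 0, _, _, rfl => trivial
  | i + 1, b, A, hi => h i b A hi

theorem le_nonmodal (Γ : Ctx) : Γ.Le .nonmodal := fun _ _ _ _ => .inr rfl

theorem le_empty (a : Aspect) : empty.Le a := nofun

theorem Le.cons {a b : Aspect} (h : Γ.Le b) (hab : a.Le b) (A : Ty) : (Γ.cons a A).Le b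
  | 0, _, _, rfl => hab
  | i + 1, c, B, hi => h i c B hi

end Ctx

theorem Aspect.Le.refl : ∀ a : Aspect, a.Le a
  | .modal => .inl rfl
  | .nonmodal => .inr rfl

namespace Typed

variable {Γ Δ : Ctx} {t s r q : Tm} {a : Aspect} {A B : Ty} {G F : BTy}

theorem union_right (h : Typed Γ t A) (hΔ : Γ.Disj Δ) : Typed (Γ.union Δ) t A := by
  induction h generalizing Δ with
  | @var _ _ a _ h => exact .var (a := a) (by simp only [Ctx.union, h, Option.some_or])
  | sub _ hAB ih => exact .sub (ih hΔ) hAB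
  | lam _ ih => exact .lam (Ctx.cons_union _ _ _ _ ▸ ih (hΔ.cons_shift _ _))
  | cst c => exact .cst c
  | caseOf hd hΓ ht hs hr _ hA _ _ _ ihq =>
    simp only [List.pairwise_cons, List.mem_cons, List.not_mem_nil, or_false, forall_eq_or_imp,
      forall_eq, Ctx.disj_union_left] at hd hΔ
    simp only [Ctx.union_assoc, Ctx.disj_union_left] at ihq ⊢
    refine .caseOf ?_ hΓ ht hs hr (ihq ⟨hΔ.1, hΔ.2.2.2.2⟩) hA
    simp_all [Ctx.disj_union_right]
  | @recursion Γ₁ Γ₂ Δ₁ _ _ _ _ _ hd hΓ₁ hΓ₂ ht _ hr hm hA _ ihs _ =>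
    simp only [List.pairwise_cons, List.mem_cons, List.not_mem_nil, or_false, forall_eq_or_imp,
      forall_eq, Ctx.disj_union_left] at hd hΔ
    rw [Ctx.union_assoc (Γ₁.union Γ₂), Ctx.union_assoc Δ₁]
    simp only [Ctx.disj_union_left] at ihs
    refine .recursion ?_ hΓ₁ hΓ₂ ht (Ctx.union_assoc _ _ Δ ▸ ihs ⟨hΔ.1, hΔ.2.2⟩) hr hm hA
    simp_all [Ctx.disj_union_right]
  | app hd hΓ _ hs ha iht _ =>
    simp only [List.pairwise_cons, List.mem_cons, List.not_mem_nil, or_false, forall_eq_or_imp,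
      forall_eq, Ctx.disj_union_left] at hd hΔ
    simp only [Ctx.union_assoc, Ctx.disj_union_left] at iht ⊢
    rw [hΔ.2.2.union_comm, ← Ctx.union_assoc _ Δ]
    refine .app ?_ hΓ (iht ⟨hΔ.1, hΔ.2.1⟩) hs ha
    simp_all [Ctx.disj_union_right, Ctx.disj_union_left, hΔ.2.2.symm]
  | pair hd hΓ ht _ _ ihs =>
    simp only [List.pairwise_cons, List.mem_cons, List.not_mem_nil, or_false, forall_eq_or_imp,
      forall_eq, Ctx.disj_union_left] at hd hΔ
    simp only [Ctx.union_assoc, Ctx.disj_union_left] at ihs ⊢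
    refine .pair ?_ hΓ ht (ihs ⟨hΔ.1, hΔ.2.2⟩)
    simp_all [Ctx.disj_union_right]
  | fst _ ih => exact .fst (ih hΔ)
  | snd _ ih => exact .snd (ih hΔ)

theorem of_empty (h : Typed .empty t A) (Γ : Ctx) : Typed Γ t A :=
  Γ.empty_union ▸ h.union_right Γ.empty_disj

theorem subst_eq_self (h : Typed Γ t A) {σ : ℕ → Tm} (hσ : ∀ i, Γ i = none ∨ σ i = .var i) :
    t.subst σ = t := by
  induction h generalizing σ with
  | var h => exact (hσ _).resolve_left (by simp [h])
  | sub _ _ ih => exact ih hσ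
  | lam _ ih =>
    rw [Tm.subst, ih]
    rintro (_ | i)
    · exact .inr rfl
    · exact (hσ i).imp_right fun hi => by rw [upSubst, hi, rename]
  | cst c => rfl
  | caseOf _ _ _ _ _ _ _ iht ihs ihr ihq =>
    simp only [Ctx.union, Option.or_eq_none_iff] at *
    rw [Tm.subst, iht, ihs, ihr, ihq] <;> grind
  | recursion _ _ _ _ _ _ _ _ iht ihs ihr =>
    simp only [Ctx.union, Option.or_eq_none_iff] at *
    rw [Tm.subst, iht, ihs, ihr] <;> grind
  | app _ _ _ _ _ iht ihs =>
    simp only [Ctx.union, Option.or_eq_none_iff] at *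
    rw [Tm.subst, iht, ihs] <;> grind
  | pair _ _ _ _ iht ihs =>
    simp only [Ctx.union, Option.or_eq_none_iff] at *
    rw [Tm.subst, iht, ihs] <;> grind
  | fst _ ih => rw [Tm.subst, ih hσ]
  | snd _ ih => rw [Tm.subst, ih hσ]

theorem subst_closed (h : Typed .empty t A) (σ : ℕ → Tm) : t.subst σ = t :=
  h.subst_eq_self fun _ => .inl rfl

theorem app_shared (hΓ : Γ.Base) (ha : Γ.Le a) (ht : Typed Γ t (.arr a A B)) (hs : Typed Γ s A) :
    Typed Γ (.app t s) B := by
  have := app (Γ := Γ) (Δ₁ := .empty) (Δ₂ := .empty) (t := t) (s := s) (a := a) (A := A) (B := B)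
    (by simp [Ctx.disj_empty]) hΓ
  simp only [Ctx.union_empty] at this
  exact this ht hs ha

theorem app_disjoint (hd : Γ.Disj Δ) (ha : Δ.Le a) (ht : Typed Γ t (.arr a A B))
    (hs : Typed Δ s A) : Typed (Γ.union Δ) (.app t s) B := by
  have := app (Γ := .empty) (Δ₁ := Γ) (Δ₂ := Δ) (t := t) (s := s) (a := a) (A := A) (B := B)
    (by simp [Ctx.empty_disj, hd]) Ctx.base_empty
  simp only [Ctx.empty_union] at this
  exact this ht hs ha

theorem app_closed (ha : Γ.Le a) (ht : Typed .empty t (.arr a A B)) (hs : Typed Γ s A) :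
    Typed Γ (.app t s) B :=
  Γ.empty_union ▸ app_disjoint Γ.empty_disj ha ht hs

theorem app_var {i : ℕ} {b : Aspect} (hi : Γ i = some (b, A)) (hb : b.Le a)
    (ht : Typed .empty t (.arr a A B)) : Typed Γ (.app t (.var i)) B := by
  have hs : Typed (Γ.only i) (.var i) A := .var (by rwa [Ctx.only, if_pos rfl])
  refine Γ.only_union_erase i ▸ (app_closed ?_ ht hs).union_right (Γ.only_disj_erase i)
  intro j c C hj
  grind [Ctx.only]

theorem var_app {i : ℕ} {b : Aspect} (hi : Γ i = some (b, .arr a A B)) (ha : (Γ.erase i).Le a)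
    (hs : Typed (Γ.erase i) s A) : Typed Γ (.app (.var i) s) B :=
  Γ.only_union_erase i ▸ app_disjoint (Γ.only_disj_erase i) ha
    (.var (by rwa [Ctx.only, if_pos rfl])) hs

theorem pair_shared (hΓ : Γ.Base) (ht : Typed Γ t (.base G)) (hs : Typed Γ s (.base F)) :
    Typed Γ (.pair t s) (.base (.prod G F)) := by
  have := pair (Γ := Γ) (Δ₁ := .empty) (Δ₂ := .empty) (t := t) (s := s) (G := G) (F := F)
    (by simp [Ctx.disj_empty]) hΓ
  simp only [Ctx.union_empty] at this
  exact this ht hs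

theorem caseOf_shared (hΓ : Γ.Base) (hA : A.BoxFree) (ht : Typed Γ t .nat) (hs : Typed Γ s A)
    (hr : Typed Γ r A) (hq : Typed Γ q A) : Typed Γ (.caseOf A t s r q) A := by
  have := caseOf (Γ := Γ) (Δ₁ := .empty) (Δ₂ := .empty) (Δ₃ := .empty) (Δ₄ := .empty)
    (t := t) (s := s) (r := r) (q := q) (A := A) (by simp [Ctx.disj_empty]) hΓ
  simp only [Ctx.union_empty] at this
  exact this ht hs hr hq hA

theorem recursion_shared (hΓ : Γ.Base) (hm : Γ.Le .modal) (hA : A.BoxFree) (ht : Typed Γ t .nat)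
    (hs : Typed Γ s A) (hr : Typed Γ r (.arr .modal .nat (.arr .nonmodal A A))) :
    Typed Γ (.recursion A t s r) A := by
  have := recursion (Γ₁ := Γ) (Γ₂ := .empty) (Δ₁ := .empty) (Δ₂ := .empty)
    (t := t) (s := s) (r := r) (A := A) (by simp [Ctx.disj_empty]) hΓ Ctx.base_empty
  simp only [Ctx.union_empty] at this
  exact this ht hs hr hm hA

end Typed

theorem Tm.rename_eq_subst (t : Tm) (ρ : ℕ → ℕ) : t.rename ρ = t.subst fun i => .var (ρ i) := by
  induction t generalizing ρ with
  | lam a A t ih =>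
    rw [Tm.rename, Tm.subst, ih]
    congr 2
    funext i
    cases i <;> rfl
  | _ => simp_all only [Tm.rename, Tm.subst]

theorem Typed.rename_closed {t : Tm} {A : Ty} (h : Typed .empty t A) (ρ : ℕ → ℕ) :
    t.rename ρ = t := by
  rw [rename_eq_subst, h.subst_closed]

/-! ### Sampling -/

/-- `Samples f t μ`: in some reduction tree of `t` every leaf is of the form `f a`, and the `a` at a
random leaf is distributed as `μ`. Unlike in `Eval`, the leaves need not be in normal form, so that
reduction trees can be grafted onto each other. -/
inductive Samples {α : Type*} (f : α → Tm) : Tm → PMF α → Prop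
  | ret (a : α) : Samples f (f a) (PMF.pure a)
  | step {t : Tm} {n : ℕ} {ts : Fin (n + 1) → Tm} {D : Fin (n + 1) → PMF α} :
      Red t ts → (∀ i, Samples f (ts i) (D i)) →
      Samples f t ((PMF.uniformOfFintype (Fin (n + 1))).bind D)

namespace Samples

variable {α β : Type*} {f : α → Tm} {g : β → Tm} {t : Tm} {μ : PMF α} {C : Tm → Tm}

theorem bind (h : Samples f t μ)
    (hC : ∀ {t : Tm} {n : ℕ} {ts : Fin (n + 1) → Tm}, Red t ts → Red (C t) fun i => C (ts i))
    {ν : α → PMF β} (hν : ∀ a ∈ μ.support, Samples g (C (f a)) (ν a)) :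
    Samples g (C t) (μ.bind ν) := by
  induction h with
  | ret a =>
    rw [PMF.pure_bind]
    exact hν a ((PMF.mem_support_pure_iff a a).2 rfl)
  | step hr _ ih =>
    rw [PMF.bind_bind]
    refine .step (hC hr) fun i => ih i fun a ha => hν a ?_
    exact (PMF.mem_support_bind_iff _ _ _).2 ⟨i, PMF.mem_support_uniformOfFintype i, ha⟩

theorem bind_pure {a : α} (h : Samples f t (PMF.pure a))
    (hC : ∀ {t : Tm} {n : ℕ} {ts : Fin (n + 1) → Tm}, Red t ts → Red (C t) fun i => C (ts i))
    {ν : PMF β} (hν : Samples g (C (f a)) ν) : Samples g (C t) ν :=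
  PMF.bind_const (PMF.pure a) ν ▸ h.bind hC fun b hb =>
    ((PMF.mem_support_pure_iff a b).1 hb).symm ▸ hν

theorem of_red {ts : Fin 1 → Tm} (h : Red t ts) (hs : Samples f (ts 0) μ) : Samples f t μ :=
  PMF.bind_const (PMF.uniformOfFintype (Fin 1)) μ ▸ .step h fun i => i.fin_one_eq_zero ▸ hs

theorem beta {a : Aspect} {G : BTy} {v : Tm} (hv : Value v) (h : Samples f (t.inst v) μ) :
    Samples f (.app (.lam a (.base G) t) v) μ :=
  .of_red (.betaBase a G t v hv) h

theorem eval (h : Samples f t μ) (hf : ∀ a, NF (f a)) : Eval t (μ.map f) := by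
  induction h with
  | ret a => exact PMF.pure_map f a ▸ .nf (hf a)
  | step hr _ ih => exact PMF.map_bind _ _ f ▸ .step hr ih

end Samples

theorem nf_num (n : ℕ) : NF (.num n) := nofun

/-! ### Functions and kernels on encoded data -/

/-- A representation of the elements of `α` by values of the base type `ty`. -/
structure Encoding (α : Type*) where
  ty : BTy
  tm : α → Tm
  value : ∀ a, Value (tm a)

namespace Encoding

variable {α β : Type*}

/-- Natural numbers, represented by numerals. -/
def nat : Encoding ℕ := ⟨.nat, .num, .num⟩

/-- Pairs, represented by pairs of representations. -/
def prod (E : Encoding α) (F : Encoding β) : Encoding (α × β) :=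
  ⟨.prod E.ty F.ty, fun x => .pair (E.tm x.1) (F.tm x.2),
    fun x => .pair (E.value x.1) (F.value x.2)⟩

/-- The elements of `α`, represented by their codes `g a`. The code need not be injective. -/
def comap (g : α → β) (E : Encoding β) : Encoding α := ⟨E.ty, E.tm ∘ g, fun a => E.value (g a)⟩

end Encoding

section Samplable

variable {α β γ : Type*}

/-- A closed term of type `a E → F` samples from the kernel `κ` on encoded data. -/
def Samplable (a : Aspect) (E : Encoding α) (F : Encoding β) (κ : α → PMF β) : Prop :=
  ∃ t, Typed .empty t (.arr a (.base E.ty) (.base F.ty)) ∧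
    ∀ x, Samples F.tm (.app t (E.tm x)) (κ x)

/-- A closed term of type `a E → F` computes the function `f` on encoded data. -/
abbrev Definable (a : Aspect) (E : Encoding α) (F : Encoding β) (f : α → β) : Prop :=
  Samplable a E F fun x => PMF.pure (f x)

variable {a : Aspect} {E : Encoding α} {F : Encoding β} {G : Encoding γ}

theorem Samplable.of_body {t : Tm} {κ : α → PMF β}
    (ht : Typed (Ctx.empty.cons a (.base E.ty)) t (.base F.ty))
    (h : ∀ x, Samples F.tm (t.inst (E.tm x)) (κ x)) : Samplable a E F κ :=
  ⟨.lam a (.base E.ty) t, .lam ht, fun x => .beta (E.value x) (h x)⟩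

theorem Samplable.comp {κ : β → PMF γ} {μ : α → PMF β} (hκ : Samplable a F G κ)
    (hμ : Samplable a E F μ) : Samplable a E G fun x => (μ x).bind κ := by
  obtain ⟨s, hs, hsκ⟩ := hκ
  obtain ⟨t, ht, htμ⟩ := hμ
  refine .of_body (t := .app s (.app t (.var 0)))
    (.app_closed ((Ctx.le_empty a).cons (.refl a) _) hs (.app_var rfl (.refl a) ht)) fun x => ?_
  simp only [inst, Tm.subst, ht.subst_closed, hs.subst_closed, single]
  exact (htμ x).bind (.appR s) fun y _ => hsκ y

theorem Samplable.caseOf {μ : α → PMF ℕ} {κ : Bool → α → PMF β} (hμ : Samplable a E .nat μ)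
    (hκ : ∀ b, Samplable a E F (κ b)) :
    Samplable a E F fun x => (μ x).bind fun n => κ n.bodd x := by
  obtain ⟨t, ht, htμ⟩ := hμ
  choose s hs hsκ using hκ
  have happ : ∀ {u A}, Typed .empty u (.arr a (.base E.ty) A) →
      Typed (Ctx.empty.cons a (.base E.ty)) (.app u (.var 0)) A := .app_var rfl (.refl a)
  refine .of_body (t := .caseOf (.base F.ty) (.app t (.var 0)) (.app (s false) (.var 0))
    (.app (s false) (.var 0)) (.app (s true) (.var 0))) (.caseOf_shared (Ctx.base_empty.cons _ _)
    trivial (happ ht) (happ (hs _)) (happ (hs _)) (happ (hs _))) fun x => ?_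
  simp only [inst, Tm.subst, ht.subst_closed, (hs _).subst_closed, single]
  refine (htμ x).bind (.case1 _ _ _ _) fun n _ => ?_
  rcases Nat.even_or_odd' n with ⟨m, rfl | rfl⟩
  · rcases eq_or_ne m 0 with rfl | hm
    · exact .of_red (.caseZero ..) (hsκ false x)
    · rw [show (2 * m).bodd = false by simp]
      exact .of_red (.caseEven _ m _ _ _ hm) (hsκ false x)
  · rw [show (2 * m + 1).bodd = true by simp]
    exact .of_red (.caseOdd _ m _ _ _) (hsκ true x)

theorem samplable_rand :
    Samplable a E .nat fun _ => (PMF.uniformOfFintype Bool).map Bool.toNat := by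
  refine .of_body (.cst .rand) fun _ => ?_
  have uniform_eq : (PMF.uniformOfFintype Bool).map Bool.toNat =
      (PMF.uniformOfFintype (Fin 2)).bind ![PMF.pure 0, PMF.pure 1] := by
    ext n
    simp [PMF.bind_apply, PMF.map, tsum_fintype, Fin.sum_univ_two, add_comm]
  exact uniform_eq ▸ .step .rand
    (Fin.forall_fin_two.2 ⟨.ret (f := Encoding.nat.tm) 0, .ret (f := Encoding.nat.tm) 1⟩)

theorem Samplable.coin {κ : Bool → α → PMF β} (hκ : ∀ b, Samplable a E F (κ b)) :
    Samplable a E F fun x => (PMF.uniformOfFintype Bool).bind fun b => κ b x := by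
  have toNat_bodd : ∀ b : Bool, b.toNat.bodd = b := by decide
  simpa only [PMF.bind_map, Function.comp_def, toNat_bodd] using samplable_rand.caseOf hκ

theorem definable_id : Definable a E E id :=
  .of_body (.var (i := 0) rfl) .ret

theorem Definable.comp {g : β → γ} {f : α → β} (hg : Definable a F G g) (hf : Definable a E F f) :
    Definable a E G fun x => g (f x) := by
  simpa only [PMF.pure_bind] using Samplable.comp hg hf

theorem Definable.prodMk {f : α → β} {g : α → γ} (hf : Definable a E F f)
    (hg : Definable a E G g) : Definable a E (F.prod G) fun x => (f x, g x) := by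
  obtain ⟨t, ht, htf⟩ := hf
  obtain ⟨s, hs, hsg⟩ := hg
  refine .of_body (t := .pair (.app t (.var 0)) (.app s (.var 0)))
    (.pair_shared (Ctx.base_empty.cons _ _) (.app_var rfl (.refl a) ht)
      (.app_var rfl (.refl a) hs)) fun x => ?_
  simp only [inst, Tm.subst, ht.subst_closed, hs.subst_closed, single]
  exact (htf x).bind_pure (.pairL _) ((hsg x).bind_pure (.pairR _) (.ret (f x, g x)))

theorem definable_fst : Definable a (E.prod F) E Prod.fst :=
  .of_body (.fst (.var (i := 0) rfl)) fun x => .of_red (.fstPair _ _) (.ret x.1)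

theorem definable_snd : Definable a (E.prod F) F Prod.snd :=
  .of_body (.snd (.var (i := 0) rfl)) fun x => .of_red (.sndPair _ _) (.ret x.2)

theorem definable_const (n : ℕ) : Definable a E .nat fun _ => n :=
  .of_body (.cst (.num n)) fun _ => .ret (f := Encoding.nat.tm) n

theorem definable_cst {c : Cst} (hc : c.ty = .arr .nonmodal .nat .nat) {f : ℕ → ℕ}
    (h : ∀ n, Red (.app (.cst c) (.num n)) ![.num (f n)]) : Definable a .nat .nat f :=
  ⟨.cst c, .sub (hc ▸ .cst c) (.arr (.refl _) (.refl _) (.inr rfl)),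
    fun n => .of_red (h n) (.ret (f := Encoding.nat.tm) (f n))⟩

theorem definable_div2 : Definable a .nat .nat Nat.div2 :=
  definable_cst (c := .P) rfl fun n => Nat.div2_val n ▸ .P n

theorem definable_bit : ∀ b, Definable a .nat .nat (Nat.bit b)
  | false => definable_cst (c := .S0) rfl .S0
  | true => definable_cst (c := .S1) rfl .S1

theorem Samplable.switch {κ : ℕ → α → PMF β} (hκ : ∀ k, Samplable a E F (κ k)) (w : ℕ)
    {f : α → ℕ} (hf : Definable a E .nat f) : Samplable a E F fun x => κ (f x % 2 ^ w) x := by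
  induction w generalizing κ f with
  | zero => simpa only [pow_zero, Nat.mod_one] using hκ 0
  | succ w ih =>
    have mod_succ : ∀ n, n % 2 ^ (w + 1) = Nat.bit n.bodd (n.div2 % 2 ^ w) := fun n => by
      rw [pow_succ', Nat.mod_mul, Nat.mod_two_of_bodd, Nat.bit_val, Nat.div2_val, add_comm]
    simpa only [mod_succ, PMF.pure_bind] using
      hf.caseOf fun b => ih (fun k => hκ (Nat.bit b k)) (definable_div2.comp hf)

theorem Definable.mod_two_pow {f : α → ℕ} (hf : Definable a E .nat f) (w : ℕ) :
    Definable a E .nat fun x => f x % 2 ^ w :=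
  .switch (fun k => definable_const k) w hf

theorem Definable.div_two_pow {f : α → ℕ} (hf : Definable a E .nat f) (w : ℕ) :
    Definable a E .nat fun x => f x / 2 ^ w := by
  induction w with
  | zero => simpa only [pow_zero, Nat.div_one] using hf
  | succ w ih =>
    simpa only [pow_succ, ← Nat.div_div_eq_div_mul, ← Nat.div2_val] using definable_div2.comp ih

theorem Definable.mul_two_pow_add {f : α → ℕ} (hf : Definable a E .nat f) {w k : ℕ}
    (hk : k < 2 ^ w) : Definable a E .nat fun x => f x * 2 ^ w + k := by
  induction w generalizing k with
  | zero => simpa [show k = 0 by simpa using hk] using hf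
  | succ w ih =>
    have hk2 : k / 2 < 2 ^ w := by rw [pow_succ] at hk; omega
    convert (definable_bit k.bodd).comp (ih hk2) using 3 with x
    rw [Nat.bit_val, ← Nat.mod_two_of_bodd, pow_succ, ← mul_assoc]
    omega

theorem definable_code (g : α → β) : Definable a (F.comap g) F g :=
  .of_body (.var (i := 0) rfl) fun x => .ret (g x)

theorem Definable.of_code {g : β → γ} {f : α → β} (h : Definable a E G fun x => g (f x)) :
    Definable a E (G.comap g) f := by
  obtain ⟨t, ht, htf⟩ := h
  exact ⟨t, ht, fun x => (htf x).bind_pure (C := id) id (.ret (f := (G.comap g).tm) (f x))⟩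

end Samplable

/-! ### Iteration -/

section Walk

variable {α : Type*}

/-- The distribution of the state of the Markov chain with transition kernel `κ` after `T` steps,
started in `a`. -/
noncomputable def walk (κ : α → PMF α) : ℕ → α → PMF α
  | 0, a => PMF.pure a
  | T + 1, a => (walk κ T a).bind κ

variable (κ : α → PMF α)

theorem walk_add (m n : ℕ) (a : α) : walk κ (m + n) a = (walk κ m a).bind (walk κ n) := by
  induction n with
  | zero => exact (PMF.bind_pure _).symm
  | succ n ih => rw [← add_assoc, walk, ih, PMF.bind_bind]; rfl

theorem walk_one : walk κ 1 = κ := funext fun a => PMF.pure_bind a κ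

theorem walk_succ (n : ℕ) (a : α) : walk κ (n + 1) a = (κ a).bind (walk κ n) := by
  rw [add_comm, walk_add, walk_one]

theorem walk_walk (m n : ℕ) : walk (walk κ m) n = walk κ (m * n) := by
  induction n with
  | zero => rfl
  | succ n ih => funext a; rw [walk, ih, Nat.mul_succ, walk_add]

theorem walk_pure (f : α → α) (n : ℕ) (a : α) :
    walk (fun a => PMF.pure (f a)) n a = PMF.pure (f^[n] a) := by
  induction n with
  | zero => rfl
  | succ n ih => rw [walk, ih, PMF.pure_bind, Function.iterate_succ_apply']

end Walk

theorem size_eq_size_div_two_add_one {n : ℕ} (hn : n ≠ 0) : n.size = (n / 2).size + 1 := by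
  conv_lhs => rw [← Nat.bit_bodd_div2 n]
  rw [Nat.size_bit (by rwa [Nat.bit_bodd_div2]), Nat.div2_val]

section ParamSamplable

variable {α β γ : Type*} {E : Encoding α} {F : Encoding β} {G : Encoding γ}

/-- The recursion on `x` that returns the `|x|`-fold iterate of a function `u` on `G`. Here `u` is
placed under three binders. -/
def iterate (G : BTy) (u x : Tm) : Tm :=
  .recursion (.arr .nonmodal (.base G) (.base G)) x (.lam .nonmodal (.base G) (.var 0))
    (.lam .modal .nat (.lam .nonmodal (.arr .nonmodal (.base G) (.base G))
      (.lam .nonmodal (.base G) (.app (.var 1) (.app u (.var 0))))))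

theorem Typed.iterate {Γ : Ctx} {G : BTy} {u x : Tm} (hΓ : Γ.Base) (hm : Γ.Le .modal)
    (hx : Typed Γ x .nat)
    (hu : Typed ((((Γ.cons .modal .nat).cons .nonmodal (.arr .nonmodal (.base G) (.base G))).cons
      .nonmodal (.base G)).erase 1) u (.arr .nonmodal (.base G) (.base G))) :
    Typed Γ (iterate G u x) (.arr .nonmodal (.base G) (.base G)) := by
  refine .recursion_shared hΓ hm ⟨rfl, trivial, trivial⟩ hx (.lam (.var rfl))
    (.lam (.lam (.lam (.var_app rfl (Ctx.le_nonmodal _)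
      (.app_shared ?_ (Ctx.le_nonmodal _) hu (.var rfl))))))
  rintro (_ | _ | _ | i) b A h
  · cases h; trivial
  · cases h
  · cases h; trivial
  · exact hΓ i b A h

theorem samples_iterate {κ : α → PMF α} {u : Tm}
    (hu : Typed .empty u (.arr .nonmodal (.base E.ty) (.base E.ty)))
    (huκ : ∀ c, Samples E.tm (.app u (E.tm c)) (κ c)) (x : ℕ) (c : α) :
    Samples E.tm (.app (iterate E.ty u (.num x)) (E.tm c)) (walk κ x.size c) := by
  induction x using Nat.strong_induction_on generalizing c with
  | _ x ih =>
    rcases eq_or_ne x 0 with rfl | hx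
    · exact .of_red (.appL _ (.recZero _ _ _)) (.beta (E.value c) (.ret c))
    have hrec : Typed .empty (iterate E.ty u (.num (x / 2)))
        (.arr .nonmodal (.base E.ty) (.base E.ty)) :=
      .iterate Ctx.base_empty (Ctx.le_empty _) (.cst _) (hu.of_empty _)
    refine .of_red (.appL _ (.recStep _ x _ _ hx))
      (.of_red (.appL _ (.appL _ (.betaBase _ _ _ _ (.num x))))
        (.of_red (.appL _ (.betaArr _ _ _ _ _ (iterate E.ty u (.num (x / 2)))))
          (.beta (E.value c) ?_)))
    simp only [inst, Tm.subst, hu.subst_closed, single, upSubst, rename,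
      hrec.rename_closed, hrec.subst_closed]
    rw [size_eq_size_div_two_add_one hx, walk_succ]
    exact (huκ c).bind (.appR _) fun d _ => ih (x / 2) (by omega) d

theorem Samplable.walk {a : Aspect} {κ : α → PMF α} (hκ : Samplable a E E κ) (T : ℕ) :
    Samplable a E E (walk κ T) := by
  induction T with
  | zero => exact definable_id
  | succ T ih => exact hκ.comp ih

/-- A closed term of type `□N → ■E → F` samples from the kernels `κ n` on encoded data: `n` may be
the argument of a recursion. -/
def ParamSamplable (E : Encoding α) (F : Encoding β) (κ : ℕ → α → PMF β) : Prop :=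
  ∃ t, Typed .empty t (.arr .modal .nat (.arr .nonmodal (.base E.ty) (.base F.ty))) ∧
    ∀ n x, Samples F.tm (.app (.app t (.num n)) (E.tm x)) (κ n x)

namespace ParamSamplable

theorem of_body {t : Tm} {κ : ℕ → α → PMF β}
    (ht : Typed (Ctx.empty.cons .modal .nat) t (.arr .nonmodal (.base E.ty) (.base F.ty)))
    (h : ∀ n x, Samples F.tm (.app (t.inst (.num n)) (E.tm x)) (κ n x)) :
    ParamSamplable E F κ :=
  ⟨.lam .modal .nat t, .lam ht, fun n x =>
    .of_red (.appL _ (.betaBase _ _ _ _ (.num n))) (h n x)⟩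

theorem const {κ : α → PMF β} (hκ : Samplable .nonmodal E F κ) :
    ParamSamplable E F fun _ => κ := by
  obtain ⟨t, ht, htκ⟩ := hκ
  exact .of_body (ht.of_empty _) fun n x => by rw [inst, ht.subst_closed]; exact htκ x

theorem comp {μ : ℕ → α → PMF β} {κ : ℕ → β → PMF γ} (hκ : ParamSamplable F G κ)
    (hμ : ParamSamplable E F μ) : ParamSamplable E G fun n x => (μ n x).bind (κ n) := by
  obtain ⟨s, hs, hsκ⟩ := hκ
  obtain ⟨t, ht, htμ⟩ := hμ
  have hΓ : ((Ctx.empty.cons .modal .nat).cons .nonmodal (.base E.ty)).Base :=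
    (Ctx.base_empty.cons _ _).cons _ _
  refine .of_body (t := .lam .nonmodal (.base E.ty)
    (.app (.app s (.var 1)) (.app (.app t (.var 1)) (.var 0))))
    (.lam (.app_shared hΓ (Ctx.le_nonmodal _) (.app_var rfl (.refl _) hs)
      (.app_shared hΓ (Ctx.le_nonmodal _) (.app_var rfl (.refl _) ht) (.var rfl)))) fun n x => ?_
  refine .beta (E.value x) ?_
  simp only [inst, Tm.subst, hs.subst_closed, ht.subst_closed, single, upSubst, rename]
  exact (htμ n x).bind (.appR _) fun y _ => hsκ n y

theorem walk_size {κ : ℕ → α → PMF α} (hκ : ParamSamplable E E κ) :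
    ParamSamplable E E fun n => walk (κ n) n.size := by
  obtain ⟨t, ht, htκ⟩ := hκ
  refine .of_body (t := iterate E.ty (.app t (.var 3)) (.var 0)) (.iterate
    (Ctx.base_empty.cons _ _) ((Ctx.le_empty _).cons (.refl _) _) (.var rfl)
    (.app_var rfl (.refl _) ht)) fun n c => ?_
  have hn : Typed .empty (.app t (.num n)) (.arr .nonmodal (.base E.ty) (.base E.ty)) :=
    .app_closed (Ctx.le_empty _) ht (.cst (.num n))
  simp only [inst, iterate, Tm.subst, ht.subst_closed, single, upSubst, rename]
  exact samples_iterate hn (htκ n) n c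

open Polynomial in
theorem walk_eval_size {κ : α → PMF α} (hκ : Samplable .nonmodal E E κ) (p : ℕ[X]) :
    ParamSamplable E E fun n => walk κ (p.eval n.size) := by
  induction p using Polynomial.induction_on with
  | C k => simpa only [eval_C] using const (hκ.walk k)
  | add p q hp hq => simpa only [eval_add, ← walk_add] using hq.comp hp
  | monomial k m h =>
    simpa only [pow_succ, ← mul_assoc, eval_mul_X, walk_walk] using h.walk_size

theorem apply {f : α → ℕ} {ν : α → PMF β} {κ : ℕ → β → PMF γ} (hκ : ParamSamplable F G κ)
    (hf : Definable .modal E .nat f) (hν : Samplable .modal E F ν) :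
    Samplable .modal E G fun x => (ν x).bind (κ (f x)) := by
  obtain ⟨t, ht, htκ⟩ := hκ
  obtain ⟨u, hu, huf⟩ := hf
  obtain ⟨s, hs, hsν⟩ := hν
  have hm : ((Ctx.empty.cons .modal (.base E.ty))).Le .modal := (Ctx.le_empty _).cons (.refl _) _
  refine .of_body (t := .app (.app t (.app u (.var 0))) (.app s (.var 0)))
    (.app_shared (Ctx.base_empty.cons _ _) (Ctx.le_nonmodal _)
      (.app_closed hm ht (.app_var rfl (.refl _) hu)) (.app_var rfl (.refl _) hs)) fun x => ?_
  simp only [inst, Tm.subst, ht.subst_closed, hu.subst_closed, hs.subst_closed, single]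
  exact (huf x).bind_pure (C := fun n => .app (.app t n) _) (fun h => .appL _ (.appR _ h))
    ((hsν x).bind (.appR _) fun y _ => htκ (f x) y)

end ParamSamplable

theorem Definable.iterate_size {g : β → β} (hg : Definable .nonmodal F F g) {f : α → ℕ}
    {h : α → β} (hf : Definable .modal E .nat f) (hh : Definable .modal E F h) :
    Definable .modal E F fun x => g^[(f x).size] (h x) := by
  simpa only [PMF.pure_bind, walk_pure] using (ParamSamplable.const hg).walk_size.apply hf hh

end ParamSamplable

/-! ### Finite alphabets and tapes -/

/-- Binary codes of `width` bits for the elements of a finite set, in which `blank` has the code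
`0`: blanks at the far end of a tape do not change its code `BlockCode.list`. -/
structure BlockCode {S : Type*} (blank : S) where
  width : ℕ
  code : S → ℕ
  code_injective : Function.Injective code
  code_lt : ∀ s, code s < 2 ^ width
  code_blank : code blank = 0

theorem nonempty_blockCode {S : Type*} [Finite S] (blank : S) : Nonempty (BlockCode blank) := by
  classical
  obtain ⟨n, ⟨e⟩⟩ := Finite.exists_equiv_fin S
  refine ⟨⟨n, fun s => Equiv.swap (e blank) ⟨0, (e blank).pos⟩ (e s), ?_, fun s => ?_, ?_⟩⟩
  · exact Fin.val_injective.comp ((Equiv.injective _).comp e.injective)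
  · exact (Fin.is_lt _).trans Nat.lt_two_pow_self
  · rw [Equiv.swap_apply_left]

namespace BlockCode

variable {S : Type*} {blank : S} (K : BlockCode blank)

/-- The code of a list of symbols, with the first symbol in the lowest bits. -/
def list : List S → ℕ
  | [] => 0
  | s :: l => list l * 2 ^ K.width + K.code s

theorem list_mod (l : List S) : K.list l % 2 ^ K.width = K.code (l.headD blank) := by
  cases l with
  | nil => rw [list, Nat.zero_mod, List.headD_nil, K.code_blank]
  | cons s l => rw [list, Nat.mul_add_mod', Nat.mod_eq_of_lt (K.code_lt s), List.headD_cons]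

theorem list_div (l : List S) : K.list l / 2 ^ K.width = K.list l.tail := by
  cases l with
  | nil => exact Nat.zero_div _
  | cons s l =>
    rw [list, Nat.mul_comm, Nat.mul_add_div (by positivity), Nat.div_eq_of_lt (K.code_lt s),
      add_zero, List.tail_cons]

theorem size_list_lt {s : S} (hs : s ≠ blank) (l : List S) :
    (K.list l).size < (K.list (s :: l)).size := by
  have hcode : K.code s ≠ 0 := K.code_blank ▸ K.code_injective.ne hs
  have hwidth : 2 ≤ 2 ^ K.width := by
    have := K.code_lt s
    by_contra!
    have := K.code_lt blank
    omega
  calc (K.list l).size < (2 * K.list l + 1).size := by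
        rw [← Nat.bit_true_apply, Nat.size_bit (by simp)]; exact Nat.lt_succ_self _
    _ ≤ (K.list (s :: l)).size := Nat.size_le_size (by
        have := Nat.mul_le_mul_left (K.list l) hwidth
        rw [list]
        omega)

/-- The representation of symbols by their codes. -/
def symbol : Encoding S := Encoding.nat.comap K.code

/-- The representation of a one-sided tape by the code of the list of its symbols. -/
def tape : Encoding (List S) := Encoding.nat.comap K.list

end BlockCode

section BlockCode

variable {α β S : Type*} {blank : S} {K : BlockCode blank} {a : Aspect} {E : Encoding α}
  {F : Encoding β}

theorem Samplable.branch {f : α → S} (hf : Definable a E K.symbol f) {κ : S → α → PMF β}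
    (hκ : ∀ s, Samplable a E F (κ s)) : Samplable a E F fun x => κ (f x) x := by
  have : Nonempty S := ⟨blank⟩
  simpa only [Nat.mod_eq_of_lt (K.code_lt _), Function.leftInverse_invFun K.code_injective _]
    using Samplable.switch (fun k => hκ (K.code.invFun k)) K.width ((definable_code K.code).comp hf)

theorem definable_symbol (s : S) : Definable a E K.symbol fun _ => s :=
  .of_code (definable_const _)

theorem definable_nil : Definable a E K.tape fun _ => [] :=
  .of_code (definable_const _)

variable {l : α → List S}

theorem definable_list : Definable a K.tape .nat K.list :=
  definable_code _

theorem Definable.headD (hl : Definable a E K.tape l) :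
    Definable a E K.symbol fun x => (l x).headD blank :=
  .of_code (by simpa only [K.list_mod] using (definable_list.comp hl).mod_two_pow K.width)

theorem Definable.tail (hl : Definable a E K.tape l) :
    Definable a E K.tape fun x => (l x).tail :=
  .of_code (by simpa only [K.list_div] using (definable_list.comp hl).div_two_pow K.width)

theorem Definable.cons (hl : Definable a E K.tape l) (s : S) :
    Definable a E K.tape fun x => s :: l x :=
  .of_code ((definable_list.comp hl).mul_two_pow_add (K.code_lt s))

theorem Definable.symbol_cons {s : α → S} (hs : Definable a E K.symbol s)
    (hl : Definable a E K.tape l) :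
    Definable a E K.tape fun x => s x :: l x :=
  Samplable.branch hs hl.cons

end BlockCode

end RSLR

/-! ### Machines -/

namespace PTM.Machine

open RSLR

variable {Q S : Type*} (M : Machine Q S)

theorem run_eq_walk (n T : ℕ) : M.run n T = walk M.stepDist T (M.initial n) := by
  induction T with
  | zero => rfl
  | succ T ih => rw [run, ih, walk]

variable {M} in
theorem HaltsWithin.run_add {n T : ℕ} (h : M.HaltsWithin n T) (U : ℕ) :
    M.run n (T + U) = M.run n T := by
  induction U with
  | zero => rfl
  | succ U ih =>
    rw [← add_assoc, run, ih]
    conv_rhs => rw [← PMF.bind_pure (M.run n T)]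
    ext d
    rw [PMF.bind_apply, PMF.bind_apply]
    refine tsum_congr fun c => ?_
    by_cases hc : c ∈ (M.run n T).support
    · rw [stepDist, if_pos (h c hc)]
    · rw [PMF.mem_support_iff, not_not] at hc
      rw [hc, zero_mul, zero_mul]

variable {M} in
theorem HaltsWithin.resultDist_eq {n T : ℕ} (hT : M.HaltsWithin n T)
    (h : ∃ T, M.HaltsWithin n T) : M.resultDist n h = (M.run n T).map M.result := by
  classical
  obtain ⟨U, rfl⟩ := Nat.exists_eq_add_of_le (Nat.find_le hT : Nat.find h ≤ T)
  rw [(Nat.find_spec h).run_add, resultDist]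

/-- The configuration after the action `(q, s, m)`: write `s`, move by `m` and enter the state
`q`. -/
def act : Q × S × Move → Cfg Q S → Cfg Q S
  | (q, s, .left), c => ⟨q, c.left.tail, c.left.headD M.blank, s :: c.right⟩
  | (q, s, .stay), c => ⟨q, c.left, s, c.right⟩
  | (q, s, .right), c => ⟨q, s :: c.left, c.right.headD M.blank, c.right.tail⟩

theorem next_eq_act (c : Cfg Q S) (b : Bool) :
    M.next c b = M.act (M.trans c.state c.head b) c := by
  unfold next act
  rcases M.trans c.state c.head b with ⟨q, s, _ | _ | _⟩ <;> rfl

/-- One step of writing the digits of a number on a tape, starting from the lowest one. -/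
def inputStep (x : ℕ × List S) : ℕ × List S := (x.1.div2, M.digit x.1.bodd :: x.2)

theorem inputStep_iterate (n : ℕ) (l : List S) :
    M.inputStep^[n.size] (n, l) = (0, M.input n ++ l) := by
  induction n using Nat.binaryRec' generalizing l with
  | zero => rfl
  | bit b n hn ih =>
    rcases eq_or_ne (Nat.bit b n) 0 with h0 | h0
    · simp [h0, input]
    · rw [Nat.size_bit h0, Function.iterate_succ_apply, inputStep, Nat.div2_bit, Nat.bodd_bit, ih,
        input, input, Nat.bits_append_bit n b hn]
      simp

open Classical in
/-- One step of reading a binary number from a tape: the rest of the tape and the value of the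
digits read so far. -/
noncomputable def readStep (x : List S × ℕ) : List S × ℕ :=
  if x.1.headD M.blank = M.digit false then (x.1.tail, Nat.bit false x.2)
  else if x.1.headD M.blank = M.digit true then (x.1.tail, Nat.bit true x.2)
  else x

theorem readStep_iterate (K : BlockCode M.blank) (l : List S) {k N : ℕ}
    (hN : (K.list l).size ≤ N) : (M.readStep^[N] (l, k)).2 = M.readFrom k l := by
  induction l generalizing k N with
  | nil =>
    rw [Function.iterate_fixed]
    · rfl
    · simp [readStep, (M.digit_ne_blank _).symm]
  | cons s l ih =>
    have ih_succ (b : Bool) (hs : s = M.digit b) : (M.readStep^[N - 1] (l, Nat.bit b k)).2 =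
        M.readFrom (Nat.bit b k) l ∧ N = N - 1 + 1 := by
      have := K.size_list_lt (hs ▸ M.digit_ne_blank b : s ≠ M.blank) l
      exact ⟨ih (by omega), by omega⟩
    rw [readFrom]
    split_ifs with h0 h1
    · obtain ⟨hl, hN⟩ := ih_succ false h0
      rw [hN, Function.iterate_succ_apply, readStep, List.headD_cons, if_pos h0]
      exact hl
    · obtain ⟨hl, hN⟩ := ih_succ true h1
      rw [hN, Function.iterate_succ_apply, readStep, List.headD_cons, if_neg h0, if_pos h1]
      exact hl
    · rw [Function.iterate_fixed]
      rw [readStep, List.headD_cons, if_neg h0, if_neg h1]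

end PTM.Machine

namespace RSLR

variable {α Q S : Type*} {M : PTM.Machine Q S} {KQ : BlockCode M.start} {K : BlockCode M.blank}
  {a : Aspect} {E : Encoding α}

/-- The representation of a configuration `(q, l, s, r)` by `⟨q, ⟨s, ⟨l, r⟩⟩⟩`. -/
def cfgEncoding (KQ : BlockCode M.start) (K : BlockCode M.blank) : Encoding (PTM.Cfg Q S) :=
  (KQ.symbol.prod (K.symbol.prod (K.tape.prod K.tape))).comap
    fun c => (c.state, c.head, c.left, c.right)

theorem definable_state : Definable a (cfgEncoding KQ K) KQ.symbol PTM.Cfg.state :=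
  definable_fst.comp (definable_code _)

theorem definable_head : Definable a (cfgEncoding KQ K) K.symbol PTM.Cfg.head :=
  definable_fst.comp (definable_snd.comp (definable_code _))

theorem definable_left : Definable a (cfgEncoding KQ K) K.tape PTM.Cfg.left :=
  definable_fst.comp (definable_snd.comp (definable_snd.comp (definable_code _)))

theorem definable_right : Definable a (cfgEncoding KQ K) K.tape PTM.Cfg.right :=
  definable_snd.comp (definable_snd.comp (definable_snd.comp (definable_code _)))

theorem Definable.cfg {q : α → Q} {l r : α → List S} {s : α → S} (hq : Definable a E KQ.symbol q)
    (hl : Definable a E K.tape l) (hs : Definable a E K.symbol s) (hr : Definable a E K.tape r) :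
    Definable a E (cfgEncoding KQ K) fun x => ⟨q x, l x, s x, r x⟩ :=
  .of_code (hq.prodMk (hs.prodMk (hl.prodMk hr)))

theorem definable_act :
    ∀ A, Definable a (cfgEncoding KQ K) (cfgEncoding KQ K) (M.act A)
  | (q, s, .left) =>
    .cfg (definable_symbol q) definable_left.tail definable_left.headD (definable_right.cons s)
  | (q, s, .stay) => .cfg (definable_symbol q) definable_left (definable_symbol s) definable_right
  | (q, s, .right) =>
    .cfg (definable_symbol q) (definable_left.cons s) definable_right.headD definable_right.tail

theorem samplable_stepDist :
    Samplable a (cfgEncoding KQ K) (cfgEncoding KQ K) M.stepDist := by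
  classical
  have step_of : ∀ q s, Samplable a (cfgEncoding KQ K) (cfgEncoding KQ K) fun c =>
      if q ∈ M.final then PMF.pure c
      else (PMF.uniformOfFintype Bool).bind fun b => PMF.pure (M.act (M.trans q s b) c) := by
    intro q s
    split_ifs
    · exact definable_id
    · exact .coin fun b => definable_act _
  convert Samplable.branch definable_state fun q => Samplable.branch definable_head (step_of q)
    with c
  rw [PTM.Machine.stepDist, PMF.map, funext (M.next_eq_act c)]
  congr!

theorem definable_inputStep :
    Definable a (Encoding.nat.prod K.tape) (Encoding.nat.prod K.tape) M.inputStep :=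
  .prodMk (definable_div2.comp definable_fst) <| by
    simpa only [PMF.pure_bind] using
      Samplable.caseOf definable_fst fun b => definable_snd.cons (M.digit b)

theorem definable_readStep :
    Definable a (K.tape.prod .nat) (K.tape.prod .nat) M.readStep := by
  classical
  refine Samplable.branch definable_fst.headD (κ := fun s x => PMF.pure
    (if s = M.digit false then (x.1.tail, Nat.bit false x.2)
    else if s = M.digit true then (x.1.tail, Nat.bit true x.2) else x)) fun s => ?_
  have hbit (b : Bool) : Definable a (K.tape.prod .nat) (K.tape.prod .nat)
      fun x => (x.1.tail, Nat.bit b x.2) :=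
    definable_fst.tail.prodMk ((definable_bit b).comp definable_snd)
  split_ifs
  exacts [hbit false, hbit true, definable_id]

theorem definable_input : Definable .modal .nat K.tape M.input := by
  simpa only [id_eq, M.inputStep_iterate, List.append_nil] using
    definable_snd.comp ((definable_inputStep (M := M) (K := K)).iterate_size definable_id
      (definable_id.prodMk definable_nil))

theorem definable_initial : Definable .modal .nat (cfgEncoding KQ K) M.initial :=
  .cfg (definable_symbol _) definable_nil definable_input.headD definable_input.tail

theorem samplable_run (p : Polynomial ℕ) :
    Samplable .modal .nat (cfgEncoding KQ K) fun n => M.run n (p.eval n.size) := by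
  simpa only [PMF.pure_bind, M.run_eq_walk, id_eq] using
    (ParamSamplable.walk_eval_size samplable_stepDist p).apply definable_id definable_initial

theorem definable_readFrom : Definable .modal K.tape .nat (M.readFrom 0) := by
  simpa only [id_eq, M.readStep_iterate K _ le_rfl] using
    definable_snd.comp ((definable_readStep (M := M)).iterate_size (definable_list (K := K))
      (definable_id.prodMk (definable_const 0)))

theorem definable_result : Definable .modal (cfgEncoding KQ K) .nat M.result :=
  definable_readFrom.comp (.symbol_cons definable_head definable_right)

end RSLR

theorem mainTheorem5 {Q S : Type*} [Finite Q] [Finite S] (M : PTM.Machine Q S)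
    (hM : M.IsPolyTime) :
    ∃ t : RSLR.Tm, RSLR.IsFirstOrder 1 t ∧
      ∀ n : ℕ, RSLR.Eval (.app t (.num n)) ((M.resultDist n (hM.halts n)).map RSLR.Tm.num) := by
  have ⟨p, hp⟩ := hM
  obtain ⟨KQ⟩ := RSLR.nonempty_blockCode M.start
  obtain ⟨K⟩ := RSLR.nonempty_blockCode M.blank
  obtain ⟨t, ht, hte⟩ := RSLR.Samplable.comp (RSLR.definable_result (KQ := KQ) (K := K))
    (RSLR.samplable_run p)
  refine ⟨t, ⟨[.modal], rfl, ht⟩, fun n => ?_⟩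
  rw [(hp n).resultDist_eq]
  exact (hte n).eval RSLR.nf_num
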